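/- A \emph{weight} is a function $v:[0,+\infty)\to(0,+\infty)$ that is continuous, non-increasing and rapidly decreasing, i.e. $\lim_{t\to+\infty}t^kv(t)=0$ for all $k\in\mathbb{N}=\{0,1,2,\dots\}$. It is \emph{normalized} if $v(t)=1$ for all $t\in[0,1]$, and \emph{convex} if $t\mapsto-\log v(e^t)$ is convex on $\mathbb{R}$. For $c>0$ let $v^c(t):=v(t)^c$, and let $H^\infty_v(\mathbb{C})$ be the space of all entire functions $f$ with $\|f\|_v:=\sup_{z\in\mathbb{C}}|f(z)|\,v(|z|)<+\infty$, with the norm $\|\cdot\|_v$. For a normalized weight $v$ let $$H^\infty_{\underline{\mathcal V}^{\mathfrak c}}(\mathbb{C}):=\varinjlim_{n\to\infty}H^\infty_{v^n}(\mathbb{C}),\qquad H^\infty_{\overline{\mathcal V}^{\mathfrak c}}(\mathbb{C}):=\varprojlim_{n\to\infty}H^\infty_{v^{1/n}}(\mathbb{C})$$ ($n\in\mathbb{N}_{>0}$) be the locally convex inductive limit (the union of the spaces) and the projective limit (their intersection). For positive functions $v,w$ on $[0,+\infty)$ write $v\vartriangleleft^{\mathfrak c}w$ if for every real $c>0$ we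 have $w(t)^c=o(v(t))$ as $t\to+\infty$. For a normalized weight $u$ put $M^u_j:=\sup_{t>0}t^ju(t)$ for $j\in\mathbb{N}$; for $M=M^u$ put $\omega_M(t):=\sup_{j\in\mathbb{N}}\log(t^j/M_j)$ for $t>0$, $\omega_M(0):=0$, and $v_M(t):=\exp(-\omega_M(t))$. \textbf{Theorem.} Let $u$ and $w$ be normalized weights and assume that $u$ is convex. Then the following are equivalent: \begin{itemize} \item[$(i)$] $u\vartriangleleft^{\mathfrak c}w$. \item[$(ii)$] For all real $c,d>0$: $H^\infty_{u^c}(\mathbb{C})\subseteq H^\infty_{w^d}(\mathbb{C})$ with continuous inclusion. \item[$(iii)$] There is $c\in\mathbb{N}_{>0}$ such that for all real $d>0$: $H^\infty_{u^c}(\mathbb{C})\subseteq H^\infty_{w^d}(\mathbb{C})$ with continuous inclusion. \item[$(iv)$] $H^\infty_{\underline{\mathcal U}^{\mathfrak c}}(\mathbb{C})\subseteq H^\infty_{\overline{\mathcal W}^{\mathfrak c}}(\mathbb{C})$ with continuous inclusion. \end{itemize} Moreover, each of $(ii)$, $(iii)$, $(iv)$ is equivalent to the same assertion with the inclusions required only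 as inclusions of sets. If $w$ is also convex, then the above assertions are further equivalent to each of: \begin{itemize} \item[$(v)$] $v_{M^u}\vartriangleleft^{\mathfrak c}v_{M^w}$. \item[$(vi)$] For all $d\in\mathbb{N}_{>0}$ there is $C\ge1$ such that $(M^w_{dj})^{1/d}\le C\,M^u_j$ for all $j\in\mathbb{N}$. \end{itemize} -/

import Mathlib

open Filter Topology Asymptotics
open scoped NNReal

noncomputable section

/-- A (radial) weight: a function `v : [0, ∞) → (0, ∞)` which is continuous, non-increasing and
rapidly decreasing. -/
structure Weight where
  toFun : ℝ≥0 → ℝ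
  pos : ∀ t, 0 < toFun t
  cont : Continuous toFun
  anti : Antitone toFun
  rapid : ∀ k : ℕ, Tendsto (fun t : ℝ≥0 => (t : ℝ) ^ k * toFun t) atTop (𝓝 0)

instance : CoeFun Weight (fun _ => ℝ≥0 → ℝ) := ⟨Weight.toFun⟩

namespace Weight

/-- `v` is normalized: `v = 1` on `[0, 1]`. -/
def IsNormalized (v : Weight) : Prop := ∀ t : ℝ≥0, t ≤ 1 → v t = 1

/-- `v` is convex: `t ↦ -log v(e^t)` is convex on `ℝ`. -/
def IsConvex (v : Weight) : Prop :=
  ConvexOn ℝ Set.univ (fun t : ℝ => -Real.log (v (Real.toNNReal (Real.exp t))))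

/-- The weight `v ^ c : t ↦ v(t) ^ c`, for real `c > 0`. -/
def rpow (v : Weight) (c : ℝ) (hc : 0 < c) : Weight where
  toFun := fun t => v t ^ c
  pos := fun t => Real.rpow_pos_of_pos (v.pos t) c
  cont := v.cont.rpow_const (fun t => Or.inl (v.pos t).ne')
  anti := fun s t h => Real.rpow_le_rpow (v.pos t).le (v.anti h) hc.le
  rapid := by
    intro k
    obtain ⟨m, hm⟩ := exists_nat_ge ((k : ℝ) / c)
    have h1 : Tendsto (fun t : ℝ≥0 => ((t : ℝ) ^ m * v t) ^ c) atTop (𝓝 0) := by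
      have := (v.rapid m).rpow_const (p := c) (Or.inr hc.le)
      rwa [Real.zero_rpow hc.ne'] at this
    refine tendsto_of_tendsto_of_tendsto_of_le_of_le' tendsto_const_nhds h1
      (Eventually.of_forall fun t =>
        mul_nonneg (pow_nonneg t.2 k) (Real.rpow_pos_of_pos (v.pos t) c).le) ?_
    filter_upwards [eventually_ge_atTop (1 : ℝ≥0)] with t ht
    have ht1 : (1 : ℝ) ≤ t := by exact_mod_cast ht
    have ht0 : (0 : ℝ) ≤ t := t.2
    rw [Real.mul_rpow (pow_nonneg ht0 m) (v.pos t).le]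
    refine mul_le_mul_of_nonneg_right ?_ (Real.rpow_pos_of_pos (v.pos t) c).le
    rw [← Real.rpow_natCast, ← Real.rpow_natCast, ← Real.rpow_mul ht0]
    exact Real.rpow_le_rpow_of_exponent_le ht1 ((div_le_iff₀ hc).1 hm)

/-! ### The Banach space of entire functions attached to a weight -/

/-- `H^∞_v(ℂ)`: the entire functions `f` with `sup_z |f(z)| v(|z|) < ∞`. -/
def HInf (v : Weight) : Submodule ℂ (ℂ → ℂ) where
  carrier := {f | Differentiable ℂ f ∧ BddAbove (Set.range fun z : ℂ => ‖f z‖ * v ‖z‖₊)}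
  zero_mem' := ⟨differentiable_const 0, ⟨0, by rintro _ ⟨z, rfl⟩; simp⟩⟩
  add_mem' := by
    rintro f g ⟨hf, A, hA⟩ ⟨hg, B, hB⟩
    refine ⟨hf.add hg, A + B, ?_⟩
    rintro _ ⟨z, rfl⟩
    calc ‖f z + g z‖ * v ‖z‖₊ ≤ (‖f z‖ + ‖g z‖) * v ‖z‖₊ :=
          mul_le_mul_of_nonneg_right (norm_add_le _ _) (v.pos _).le
      _ = ‖f z‖ * v ‖z‖₊ + ‖g z‖ * v ‖z‖₊ := add_mul _ _ _
      _ ≤ A + B := add_le_add (hA ⟨z, rfl⟩) (hB ⟨z, rfl⟩)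
  smul_mem' := by
    rintro c f ⟨hf, A, hA⟩
    refine ⟨hf.const_smul c, ‖c‖ * A, ?_⟩
    rintro _ ⟨z, rfl⟩
    calc ‖(c • f) z‖ * v ‖z‖₊ = ‖c‖ * (‖f z‖ * v ‖z‖₊) := by
          rw [Pi.smul_apply, norm_smul, mul_assoc]
      _ ≤ ‖c‖ * A := mul_le_mul_of_nonneg_left (hA ⟨z, rfl⟩) (norm_nonneg c)

/-- The norm `‖f‖_v = sup_z |f(z)| v(|z|)` on `H^∞_v(ℂ)`. -/
def hInfNorm (v : Weight) : AddGroupNorm v.HInf where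
  toFun := fun f => ⨆ z : ℂ, ‖f.1 z‖ * v ‖z‖₊
  map_zero' := by simp
  add_le' := by
    intro f g
    refine ciSup_le fun z => ?_
    calc ‖f.1 z + g.1 z‖ * v ‖z‖₊ ≤ (‖f.1 z‖ + ‖g.1 z‖) * v ‖z‖₊ :=
          mul_le_mul_of_nonneg_right (norm_add_le _ _) (v.pos _).le
      _ = ‖f.1 z‖ * v ‖z‖₊ + ‖g.1 z‖ * v ‖z‖₊ := add_mul _ _ _
      _ ≤ _ := add_le_add (le_ciSup f.2.2 z) (le_ciSup g.2.2 z)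
  neg' := by intro f; simp
  eq_zero_of_map_eq_zero' := by
    intro f hf
    ext z
    have h1 : ‖f.1 z‖ * v ‖z‖₊ ≤ 0 := hf ▸ le_ciSup f.2.2 z
    have h2 : ‖f.1 z‖ ≤ 0 := by
      by_contra h
      exact absurd h1 (not_le.2 (mul_pos (not_le.1 h) (v.pos _)))
    simpa using h2

/-- The topology of the normed space `(H^∞_v(ℂ), ‖·‖_v)`; it is always passed explicitly, and is
not the topology of pointwise convergence that Lean would infer for functions `ℂ → ℂ`. -/
@[reducible] def hInfTopology (v : Weight) : TopologicalSpace v.HInf :=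
  v.hInfNorm.toNormedAddCommGroup.toMetricSpace.toUniformSpace.toTopologicalSpace

/-- `H^∞_v(ℂ) ⊆ H^∞_w(ℂ)` with continuous inclusion. -/
def ContIncl (v w : Weight) : Prop :=
  ∃ h : v.HInf ≤ w.HInf, Continuous[v.hInfTopology, w.hInfTopology] (Submodule.inclusion h)

/-! ### Inductive and projective limits of a sequence of weights -/

/-- The vector space underlying the inductive limit of the spaces `H^∞_{V_n}(ℂ)`. For a
non-increasing sequence `V` these spaces increase, and this is their union. -/
def HInd (V : ℕ+ → Weight) : Submodule ℂ (ℂ → ℂ) := ⨆ n, (V n).HInf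

theorem hInf_le_hInd (V : ℕ+ → Weight) (n : ℕ+) : (V n).HInf ≤ HInd V :=
  le_iSup (fun m => (V m).HInf) n

/-- The inductive limit topology: the finest locally convex vector space topology for which all
the inclusions `H^∞_{V_n}(ℂ) → HInd V` are continuous. -/
@[reducible] def hIndTopology (V : ℕ+ → Weight) : TopologicalSpace (HInd V) :=
  sInf {τ | @IsTopologicalAddGroup (HInd V) τ _ ∧ @ContinuousSMul ℂ (HInd V) _ _ τ ∧
    @LocallyConvexSpace ℝ (HInd V) _ _ _ _ τ ∧
    ∀ n, Continuous[(V n).hInfTopology, τ]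
      (Submodule.inclusion (hInf_le_hInd V n))}

/-- The vector space underlying the projective limit of the spaces `H^∞_{V_n}(ℂ)`: their
intersection. -/
def HProj (V : ℕ+ → Weight) : Submodule ℂ (ℂ → ℂ) := ⨅ n, (V n).HInf

theorem hProj_le_hInf (V : ℕ+ → Weight) (n : ℕ+) : HProj V ≤ (V n).HInf :=
  iInf_le (fun m => (V m).HInf) n

/-- The projective limit topology: the coarsest topology for which all the inclusions
`HProj V → H^∞_{V_n}(ℂ)` are continuous. -/
@[reducible] def hProjTopology (V : ℕ+ → Weight) : TopologicalSpace (HProj V) :=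
  ⨅ n, (V n).hInfTopology.induced (Submodule.inclusion (hProj_le_hInf V n))

/-- The inductive exponential system `(v ^ n)`, `n ≥ 1`. -/
def indExp (v : Weight) : ℕ+ → Weight := fun n => v.rpow n (by exact_mod_cast n.pos)

/-- The projective exponential system `(v ^ (1 / n))`, `n ≥ 1`. -/
def projExp (v : Weight) : ℕ+ → Weight := fun n =>
  v.rpow (1 / n) (one_div_pos.2 (by exact_mod_cast n.pos))

/-- `HInd V ⊆ HProj W` with continuous inclusion. -/
def ContInclIndProj (V W : ℕ+ → Weight) : Prop :=
  ∃ h : HInd V ≤ HProj W, Continuous[hIndTopology V, hProjTopology W] (Submodule.inclusion h)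

/-! ### Associated sequences and functions -/

/-- The sequence associated with the weight `u`: `M^u_j = sup_{t > 0} t ^ j u(t)`. The supremum is
finite since `u` is continuous and rapidly decreasing. -/
def assocSeq (u : Weight) (j : ℕ) : ℝ := ⨆ t : Set.Ioi (0 : ℝ≥0), ((t : ℝ≥0) : ℝ) ^ j * u t

end Weight

/-- The function associated with a sequence `M`: `ω_M(t) = sup_j log (t ^ j / M_j)` for `t > 0` and
`ω_M(0) = 0`. The supremum is finite if `M` is positive with `M_j ^ (1 / j) → ∞`, in particular for
`M = M^u`, where `t ^ j / M^u_j ≤ 1 / u(t)`. -/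
def assocFun (M : ℕ → ℝ) (t : ℝ≥0) : ℝ :=
  if t = 0 then 0 else ⨆ j : ℕ, Real.log ((t : ℝ) ^ j / M j)

/-- `v_M(t) = exp(-ω_M(t))`. -/
def seqWeight (M : ℕ → ℝ) (t : ℝ≥0) : ℝ := Real.exp (-assocFun M t)

/-- `v ◁ w`: `w(t) = o(v(t))` as `t → ∞`. -/
def StrongRel (v w : ℝ≥0 → ℝ) : Prop := w =o[atTop] v

/-- `v ◁^c w`: `v ◁ w ^ c` for every real `c > 0`. -/
def StrongRelPow (v w : ℝ≥0 → ℝ) : Prop := ∀ c : ℝ, 0 < c → StrongRel v (fun t => w t ^ c)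

end

/-! Sufficiency of `u ◁^c w` is a pointwise comparison: it gives `w ^ d ≤ C u ^ c` everywhere
(`exists_rpow_le_of_strongRelPow`), so every inclusion holds and is bounded.

For necessity, bare set inclusions suffice. A lacunary series with positive coefficients
(`exists_pow_mul_le_of_hInf_le`) turns `H_u ⊆ H_{w^(1/n)}` into `t ^ j w(t) ^ (1/n) ≤ C M^u_j`,
uniformly in `j`. Convexity enters through `IsConvex.exists_assocSeq_le`: a supporting line of `-log
u(e^x)`, its slope rounded down to an integer `j`, gives `M^u_j / t ^ j ≤ t u(t)`. Hence `w ^ (1/n)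
≤ C t u`, and the stray factor `t` is absorbed by a spare power of the rapidly decreasing `w`
(`strongRelPow_of_pow_mul_rpow_le`).

The same estimate gives `u ≤ v_{M^u} ≤ t u` for `t ≥ 1`, which carries the relation between weights
and associated weights. The condition on sequences is the monomial estimate after taking suprema
over `t`. -/

theorem ConvexOn.exists_supporting_line {f : ℝ → ℝ} (hf : ConvexOn ℝ Set.univ f) (x : ℝ) :
    ∃ s : ℝ, ∀ y, f x + s * (y - x) ≤ f y := by
  have hx : x ∈ interior (Set.univ : Set ℝ) := by simp
  refine ⟨derivWithin f (Set.Ioi x) x, fun y => ?_⟩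
  rcases lt_trichotomy y x with h | rfl | h
  · have h1 := (hf.slope_le_leftDeriv_of_mem_interior (Set.mem_univ y) hx h).trans
      (hf.leftDeriv_le_rightDeriv_of_mem_interior hx)
    rw [slope_def_field, div_le_iff₀ (sub_pos.2 h)] at h1
    linarith
  · simp
  · have h1 := hf.rightDeriv_le_slope_of_mem_interior hx (Set.mem_univ y) h
    rw [slope_def_field, le_div_iff₀ (sub_pos.2 h)] at h1
    linarith

theorem Asymptotics.isLittleO_of_eventually_le_mul {α : Type*} {l : Filter α} {f g h : α → ℝ}
    (hf : ∀ᶠ t in l, ‖f t‖ ≤ g t * ‖h t‖) (hg : Tendsto g l (𝓝 0)) : f =o[l] h := by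
  refine isLittleO_iff.2 fun c hc => ?_
  filter_upwards [hf, hg.eventually_le_const hc] with t h1 h2
  exact h1.trans (mul_le_mul_of_nonneg_right h2 (norm_nonneg _))

namespace Weight

/-! ### Elementary bounds for weights -/

theorem IsNormalized.le_one {v : Weight} (hv : v.IsNormalized) (t : ℝ≥0) : v t ≤ 1 :=
  (hv 0 zero_le_one) ▸ v.anti (zero_le (a := t))

theorem tendsto_pow_mul_rpow (v : Weight) {c : ℝ} (hc : 0 < c) (k : ℕ) :
    Tendsto (fun t : ℝ≥0 => (t : ℝ) ^ k * v t ^ c) atTop (𝓝 0) :=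
  (v.rpow c hc).rapid k

theorem bddAbove_pow_mul (v : Weight) (k : ℕ) :
    BddAbove (Set.range fun t : ℝ≥0 => (t : ℝ) ^ k * v t) := by
  obtain ⟨T, hT⟩ := eventually_atTop.1 ((v.rapid k).eventually_le_const one_pos)
  refine ⟨max 1 ((T : ℝ) ^ k * v 0), ?_⟩
  rintro _ ⟨t, rfl⟩
  rcases le_total T t with h | h
  · exact (hT t h).trans (le_max_left _ _)
  · refine le_trans ?_ (le_max_right _ _)
    have h' : (t : ℝ) ≤ T := by exact_mod_cast h
    exact mul_le_mul (pow_le_pow_left₀ t.2 h' k) (v.anti (zero_le (a := t))) (v.pos t).le (by positivity)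

theorem pow_mul_le_assocSeq (v : Weight) (j : ℕ) {t : ℝ≥0} (ht : 0 < t) :
    (t : ℝ) ^ j * v t ≤ v.assocSeq j := by
  refine le_ciSup (f := fun t : Set.Ioi (0 : ℝ≥0) => ((t : ℝ≥0) : ℝ) ^ j * v t) ?_ ⟨t, ht⟩
  refine (v.bddAbove_pow_mul j).mono ?_
  rintro _ ⟨s, rfl⟩
  exact ⟨s, rfl⟩

theorem assocSeq_le (v : Weight) (j : ℕ) {C : ℝ} (h : ∀ t : ℝ≥0, 0 < t → (t : ℝ) ^ j * v t ≤ C) :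
    v.assocSeq j ≤ C := by
  have : Nonempty (Set.Ioi (0 : ℝ≥0)) := ⟨⟨1, Set.mem_Ioi.2 one_pos⟩⟩
  exact ciSup_le fun t => h t t.2

theorem assocSeq_pos (v : Weight) (j : ℕ) : 0 < v.assocSeq j :=
  (mul_pos (by simp) (v.pos 1)).trans_le (v.pow_mul_le_assocSeq j one_pos)

theorem IsNormalized.assocSeq_zero {v : Weight} (hv : v.IsNormalized) : v.assocSeq 0 = 1 :=
  le_antisymm (v.assocSeq_le 0 fun t _ => by simpa using hv.le_one t)
    (by simpa [hv 1 le_rfl] using v.pow_mul_le_assocSeq 0 one_pos)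

/-- For normalized weights the bound `t ^ j u(t) ≤ M^u_j` also holds at `t = 0`. -/
theorem IsNormalized.pow_mul_le_assocSeq {v : Weight} (hv : v.IsNormalized) (j : ℕ) (t : ℝ≥0) :
    (t : ℝ) ^ j * v t ≤ v.assocSeq j := by
  rcases eq_or_ne t 0 with rfl | ht
  · rcases eq_or_ne j 0 with rfl | hj
    · simp [hv.assocSeq_zero, hv 0 zero_le_one]
    · simpa [hj] using (v.assocSeq_pos j).le
  · exact v.pow_mul_le_assocSeq j (pos_iff_ne_zero.2 ht)

/-- A convex normalized weight is recovered from its associated sequence up to a factor `t`. -/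
theorem IsConvex.exists_assocSeq_le {u : Weight} (huc : u.IsConvex) (hu : u.IsNormalized)
    {t : ℝ≥0} (ht : 1 ≤ t) : ∃ j : ℕ, u.assocSeq j ≤ (t : ℝ) ^ (j + 1) * u t := by
  set φ : ℝ → ℝ := fun x => -Real.log (u (Real.toNNReal (Real.exp x))) with hφ
  have ht1 : (1 : ℝ) ≤ t := by exact_mod_cast ht
  have ht0 : (0 : ℝ) < t := one_pos.trans_le ht1
  have hφlog : ∀ r : ℝ≥0, 0 < r → φ (Real.log r) = -Real.log (u r) := by
    intro r hr
    simp only [hφ]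
    rw [Real.exp_log (by exact_mod_cast hr), Real.toNNReal_coe]
  have hφ0 : ∀ y ≤ 0, φ y = 0 := by
    intro y hy
    simp only [hφ]
    rw [hu _ (Real.toNNReal_le_one.2 (Real.exp_le_one_iff.2 hy))]
    simp
  have hmono : ∀ x y, x ≤ y → φ x ≤ φ y := fun x y hxy =>
    neg_le_neg (Real.log_le_log (u.pos _)
      (u.anti (Real.toNNReal_le_toNNReal (Real.exp_le_exp.2 hxy))))
  set x := Real.log t with hx
  have hx0 : 0 ≤ x := Real.log_nonneg ht1
  obtain ⟨s, hs⟩ := ConvexOn.exists_supporting_line huc x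
  change ∀ y, φ x + s * (y - x) ≤ φ y at hs
  have hs0 : 0 ≤ s := by
    have h1 := hs (x - 1)
    have h2 := hmono (x - 1) x (by linarith)
    linarith
  -- Rounding `s` down keeps the line below `φ` for `y ≥ 0`; the loss, at most `x = log t`, is the
  -- extra factor `t`. For `y ≤ 0`, where `φ` vanishes, the supporting line evaluated at `0` does
  -- the job.
  set j := ⌊s⌋₊
  have hj1 : (j : ℝ) ≤ s := Nat.floor_le hs0
  have hj2 : s ≤ (j : ℝ) + 1 := (Nat.lt_floor_add_one s).le
  have key : ∀ y, j * y - φ y ≤ ((j : ℝ) + 1) * x - φ x := by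
    intro y
    have h3 : s * x ≤ ((j : ℝ) + 1) * x := mul_le_mul_of_nonneg_right hj2 hx0
    rcases le_total 0 y with hy | hy
    · have h1 := hs y
      have h2 : j * y ≤ s * y := mul_le_mul_of_nonneg_right hj1 hy
      linarith
    · have h1 := hs 0
      rw [hφ0 0 le_rfl] at h1
      rw [hφ0 y hy]
      have h2 : (j : ℝ) * y ≤ 0 := mul_nonpos_of_nonneg_of_nonpos (Nat.cast_nonneg j) hy
      linarith
  refine ⟨j, u.assocSeq_le j fun r hr => ?_⟩
  have hr0 : (0 : ℝ) < r := by exact_mod_cast hr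
  have h := key (Real.log r)
  rw [hφlog r hr, hx, hφlog t (one_pos.trans_le ht)] at h
  rw [← Real.log_le_log_iff (mul_pos (pow_pos hr0 _) (u.pos _)) (mul_pos (pow_pos ht0 _) (u.pos _)),
    Real.log_mul (pow_pos hr0 _).ne' (u.pos _).ne', Real.log_mul (pow_pos ht0 _).ne' (u.pos _).ne',
    Real.log_pow, Real.log_pow]
  push_cast
  linarith

/-! ### The relation `◁^c` -/

/-- The relation `u ◁^c w` gives `w ^ d ≤ C u ^ c` on `[0, ∞)` for all exponents. -/
theorem exists_rpow_le_of_strongRelPow {u w : Weight} (hw : w.IsNormalized)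
    (h : StrongRelPow u w) {c d : ℝ} (hc : 0 < c) (hd : 0 < d) :
    ∃ C : ℝ, 1 ≤ C ∧ ∀ t, w t ^ d ≤ C * u t ^ c := by
  obtain ⟨T, hT⟩ := eventually_atTop.1
    ((isLittleO_iff.1 (h (d / c) (div_pos hd hc))) one_pos)
  have hpos := Real.rpow_pos_of_pos (u.pos T) c
  -- Beyond `T` the constant `1` works; on `[0, T]`, `w ≤ 1` and `u ≥ u T`.
  refine ⟨max 1 (1 / u T ^ c), le_max_left _ _, fun t => ?_⟩
  rcases le_total T t with ht | ht
  · have h1 := hT t ht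
    rw [one_mul, Real.norm_of_nonneg (Real.rpow_pos_of_pos (w.pos t) _).le,
      Real.norm_of_nonneg (u.pos t).le] at h1
    have h2 := Real.rpow_le_rpow (Real.rpow_pos_of_pos (w.pos t) _).le h1 hc.le
    rw [← Real.rpow_mul (w.pos t).le, div_mul_cancel₀ _ hc.ne'] at h2
    exact h2.trans (le_mul_of_one_le_left (Real.rpow_pos_of_pos (u.pos t) c).le (le_max_left _ _))
  · calc w t ^ d ≤ 1 := Real.rpow_le_one (w.pos t).le (hw.le_one t) hd.le
      _ = 1 / u T ^ c * u T ^ c := by field_simp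
      _ ≤ max 1 (1 / u T ^ c) * u t ^ c :=
        mul_le_mul (le_max_right _ _) (Real.rpow_le_rpow (u.pos T).le (u.anti ht) hc.le) hpos.le
          (zero_le_one.trans (le_max_left _ _))

/-- If all roots of `w` are dominated by the majorants `M^u_j / t ^ j`, then `u ◁^c w`. -/
theorem strongRelPow_of_pow_mul_rpow_le {u w : Weight} (hu : u.IsNormalized) (huc : u.IsConvex)
    (hw : w.IsNormalized)
    (h : ∀ n : ℕ, 1 ≤ n → ∃ C : ℝ, ∀ (j : ℕ) (t : ℝ≥0), 1 ≤ t →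
      (t : ℝ) ^ j * w t ^ (1 / (n : ℝ)) ≤ C * u.assocSeq j) :
    StrongRelPow u w := by
  intro c hc
  -- This makes `1 / n < c / 2`: one half of `w ^ c` is bounded by `C t u`, the other half kills
  -- `t`.
  obtain ⟨n, hn⟩ := exists_nat_gt (2 / c)
  have hn0 : (0 : ℝ) < n := (by positivity : (0 : ℝ) < 2 / c).trans hn
  obtain ⟨C, hC⟩ := h n (by exact_mod_cast hn0)
  have hnc : 1 / (n : ℝ) ≤ c / 2 := by
    rw [div_lt_iff₀ hc] at hn
    rw [div_le_div_iff₀ hn0 two_pos]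
    linarith
  have hlim : Tendsto (fun t : ℝ≥0 => |C| * ((t : ℝ) ^ 1 * w t ^ (c / 2))) atTop (𝓝 0) := by
    simpa using (w.tendsto_pow_mul_rpow (half_pos hc) 1).const_mul |C|
  refine isLittleO_of_eventually_le_mul ?_ hlim
  filter_upwards [eventually_ge_atTop 1] with t ht
  have ht0 : (0 : ℝ) < t := by exact_mod_cast one_pos.trans_le ht
  obtain ⟨j, hj⟩ := huc.exists_assocSeq_le hu ht
  have hwp : ∀ a : ℝ, 0 < w t ^ a := fun a => Real.rpow_pos_of_pos (w.pos t) a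
  have h1 : w t ^ (1 / (n : ℝ)) ≤ |C| * (t * u t) := by
    have h2 : (t : ℝ) ^ j * w t ^ (1 / (n : ℝ)) ≤ (t : ℝ) ^ j * (|C| * (t * u t)) :=
      calc _ ≤ C * u.assocSeq j := hC j t ht
        _ ≤ |C| * u.assocSeq j := mul_le_mul_of_nonneg_right (le_abs_self C) (u.assocSeq_pos j).le
        _ ≤ |C| * ((t : ℝ) ^ (j + 1) * u t) := mul_le_mul_of_nonneg_left hj (abs_nonneg C)
        _ = _ := by ring
    exact le_of_mul_le_mul_left h2 (pow_pos ht0 j)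
  rw [Real.norm_of_nonneg (hwp c).le, Real.norm_of_nonneg (u.pos t).le]
  calc w t ^ c = w t ^ (c / 2) * w t ^ (c / 2) := by
        rw [← Real.rpow_add (w.pos t), add_halves]
    _ ≤ w t ^ (1 / (n : ℝ)) * w t ^ (c / 2) := mul_le_mul_of_nonneg_right
        (Real.rpow_le_rpow_of_exponent_ge (w.pos t) (hw.le_one t) hnc) (hwp _).le
    _ ≤ |C| * (t * u t) * w t ^ (c / 2) := mul_le_mul_of_nonneg_right h1 (hwp _).le
    _ = _ := by ring

/-! ### Necessity: a lacunary power series -/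

/-- An inclusion `H^∞_u ⊆ H^∞_v` bounds the `v`-norms of the normalized monomials. -/
theorem exists_pow_mul_le_of_hInf_le {u v : Weight} (hu : u.IsNormalized)
    (h : u.HInf ≤ v.HInf) :
    ∃ C : ℝ, ∀ (j : ℕ) (t : ℝ≥0), (t : ℝ) ^ j * v t ≤ C * u.assocSeq j := by
  -- Failures with constants `4 ^ k`, weighted by `2 ^ (-k)`, sum to an `f` of `u`-norm at most `2`,
  -- while the `k`-th term alone forces `2 ^ k` at the point `t k`. The exponents `j k` need not be
  -- distinct.
  by_contra! hcon
  choose j t hjt using fun k : ℕ => hcon ((4 : ℝ) ^ k)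
  set a : ℕ → ℝ := fun k => (1 / 2 : ℝ) ^ k / u.assocSeq (j k) with ha
  have ha0 : ∀ k, 0 < a k := fun k => div_pos (by positivity) (u.assocSeq_pos _)
  have hbd : ∀ (k : ℕ) (r : ℝ≥0), a k * (r : ℝ) ^ j k ≤ (1 / 2 : ℝ) ^ k * (u r)⁻¹ := by
    intro k r
    have h1 := hu.pow_mul_le_assocSeq (j k) r
    simp only [ha]
    rw [div_mul_eq_mul_div, mul_div_assoc]
    refine mul_le_mul_of_nonneg_left ?_ (by positivity)
    rw [div_le_iff₀ (u.assocSeq_pos _), ← div_eq_inv_mul, le_div_iff₀ (u.pos r)]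
    exact h1
  have hsum : ∀ r : ℝ≥0, Summable fun k : ℕ => (1 / 2 : ℝ) ^ k * (u r)⁻¹ := fun r =>
    summable_geometric_two.mul_right _
  have hnorm : ∀ (k : ℕ) (z : ℂ), ‖(a k : ℂ) * z ^ j k‖ = a k * (‖z‖₊ : ℝ) ^ j k := by
    intro k z
    rw [norm_mul, norm_pow, Complex.norm_real, Real.norm_of_nonneg (ha0 k).le, coe_nnnorm]
  have hsumz : ∀ z : ℂ, Summable fun k => ‖(a k : ℂ) * z ^ j k‖ := fun z =>
    Summable.of_nonneg_of_le (fun _ => norm_nonneg _)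
      (fun k => (hnorm k z).trans_le (hbd k ‖z‖₊)) (hsum _)
  set f : ℂ → ℂ := fun z => ∑' k, (a k : ℂ) * z ^ j k with hf
  have hdiff : Differentiable ℂ f := by
    intro z
    refine (Complex.differentiableOn_tsum_of_summable_norm (U := Metric.ball 0 (‖z‖ + 1))
      (hsum (‖z‖₊ + 1)) (fun k => ?_) Metric.isOpen_ball fun k w hw => ?_).differentiableAt
      (Metric.isOpen_ball.mem_nhds (by simp))
    · exact ((differentiable_id.pow _).const_mul _).differentiableOn
    · rw [hnorm]
      refine le_trans (mul_le_mul_of_nonneg_left ?_ (ha0 k).le) (hbd k (‖z‖₊ + 1))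
      refine pow_le_pow_left₀ (NNReal.coe_nonneg _) ?_ _
      have : ‖w‖ < ‖z‖ + 1 := by simpa using hw
      exact this.le
  have hmem : f ∈ u.HInf := by
    refine ⟨hdiff, 2, ?_⟩
    rintro _ ⟨z, rfl⟩
    have h1 : ‖f z‖ ≤ 2 * (u ‖z‖₊)⁻¹ := by
      calc ‖f z‖ ≤ ∑' k, ‖(a k : ℂ) * z ^ j k‖ := norm_tsum_le_tsum_norm (hsumz z)
        _ ≤ ∑' k : ℕ, (1 / 2 : ℝ) ^ k * (u ‖z‖₊)⁻¹ :=
          (hsumz z).tsum_le_tsum (fun k => (hnorm k z).trans_le (hbd k ‖z‖₊)) (hsum _)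
        _ = 2 * (u ‖z‖₊)⁻¹ := by rw [tsum_mul_right, tsum_geometric_two]
    calc ‖f z‖ * u ‖z‖₊ ≤ 2 * (u ‖z‖₊)⁻¹ * u ‖z‖₊ :=
          mul_le_mul_of_nonneg_right h1 (u.pos _).le
      _ = 2 := inv_mul_cancel_right₀ (u.pos _).ne' 2
  obtain ⟨-, B, hB⟩ := h hmem
  have hlow : ∀ k : ℕ, (2 : ℝ) ^ k ≤ B := by
    intro k
    have hz : ‖((t k : ℝ) : ℂ)‖₊ = t k := by
      ext; simp
    have h1 : ‖f (t k : ℝ)‖ * v (t k) ≤ B := by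
      have := hB ⟨((t k : ℝ) : ℂ), rfl⟩
      simpa only [hz] using this
    -- On the nonnegative axis all terms are nonnegative, so nothing cancels and `f` dominates each
    -- term.
    have hre : f (t k : ℝ) = ((∑' i, a i * (t k : ℝ) ^ j i : ℝ) : ℂ) := by
      simp only [hf]
      push_cast
      rfl
    have hs : Summable fun i => a i * (t k : ℝ) ^ j i :=
      Summable.of_nonneg_of_le (fun i => mul_nonneg (ha0 i).le (by positivity))
        (fun i => hbd i (t k)) (hsum _)
    have h2 : a k * (t k : ℝ) ^ j k ≤ ‖f (t k : ℝ)‖ := by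
      rw [hre, Complex.norm_real]
      exact (hs.le_tsum k fun i _ => mul_nonneg (ha0 i).le (by positivity)).trans
        (Real.le_norm_self _)
    calc (2 : ℝ) ^ k = (1 / 2) ^ k * 4 ^ k := by rw [← mul_pow]; norm_num
      _ = a k * (4 ^ k * u.assocSeq (j k)) := by
        simp only [ha]
        field_simp [(u.assocSeq_pos (j k)).ne']
      _ ≤ a k * ((t k : ℝ) ^ j k * v (t k)) :=
        mul_le_mul_of_nonneg_left (hjt k).le (ha0 k).le
      _ = a k * (t k : ℝ) ^ j k * v (t k) := by ring
      _ ≤ ‖f (t k : ℝ)‖ * v (t k) := mul_le_mul_of_nonneg_right h2 (v.pos _).le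
      _ ≤ B := h1
  obtain ⟨k, hk⟩ := pow_unbounded_of_one_lt B (one_lt_two : (1 : ℝ) < 2)
  exact absurd (hlow k) (not_le.2 hk)

theorem strongRelPow_of_hInf_le {u w : Weight} (hu : u.IsNormalized) (huc : u.IsConvex)
    (hw : w.IsNormalized)
    (h : ∀ n : ℕ, ∀ hn : 0 < 1 / (n : ℝ), u.HInf ≤ (w.rpow (1 / n) hn).HInf) :
    StrongRelPow u w := by
  refine strongRelPow_of_pow_mul_rpow_le hu huc hw fun n hn => ?_
  obtain ⟨C, hC⟩ := exists_pow_mul_le_of_hInf_le hu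
    (h n (one_div_pos.2 (by exact_mod_cast hn)))
  exact ⟨C, fun j t _ => hC j t⟩

/-! ### Inclusions between the spaces -/

theorem hInf_mono {u v : Weight} {C : ℝ} (h : ∀ t, v t ≤ C * u t) : u.HInf ≤ v.HInf := by
  rintro f ⟨hf, B, hB⟩
  have hC : 0 ≤ C := le_of_mul_le_mul_right
    ((zero_mul (u 0)).trans_le ((v.pos 0).le.trans (h 0))) (u.pos 0)
  refine ⟨hf, C * B, ?_⟩
  rintro _ ⟨z, rfl⟩
  calc ‖f z‖ * v ‖z‖₊ ≤ ‖f z‖ * (C * u ‖z‖₊) :=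
        mul_le_mul_of_nonneg_left (h _) (norm_nonneg _)
    _ = C * (‖f z‖ * u ‖z‖₊) := by ring
    _ ≤ C * B := mul_le_mul_of_nonneg_left (hB ⟨z, rfl⟩) hC

theorem contIncl_of_le {u v : Weight} {C : ℝ} (h : ∀ t, v t ≤ C * u t) : ContIncl u v := by
  have hC : 0 ≤ C := le_of_mul_le_mul_right
    ((zero_mul (u 0)).trans_le ((v.pos 0).le.trans (h 0))) (u.pos 0)
  refine ⟨hInf_mono h, ?_⟩
  let := u.hInfNorm.toNormedAddCommGroup
  let := v.hInfNorm.toNormedAddCommGroup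
  refine AddMonoidHomClass.continuous_of_bound (Submodule.inclusion (hInf_mono h)) C fun f => ?_
  change (⨆ z : ℂ, ‖f.1 z‖ * v ‖z‖₊) ≤ C * ⨆ z : ℂ, ‖f.1 z‖ * u ‖z‖₊
  refine ciSup_le fun z => ?_
  calc ‖f.1 z‖ * v ‖z‖₊ ≤ ‖f.1 z‖ * (C * u ‖z‖₊) :=
        mul_le_mul_of_nonneg_left (h _) (norm_nonneg _)
    _ = C * (‖f.1 z‖ * u ‖z‖₊) := by ring
    _ ≤ _ := mul_le_mul_of_nonneg_left (le_ciSup f.2.2 z) hC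

theorem hInfNorm_smul (v : Weight) (c : ℂ) (f : v.HInf) :
    v.hInfNorm (c • f) = ‖c‖ * v.hInfNorm f := by
  change (⨆ z : ℂ, ‖c • f.1 z‖ * v ‖z‖₊) = ‖c‖ * ⨆ z : ℂ, ‖f.1 z‖ * v ‖z‖₊
  rw [Real.mul_iSup_of_nonneg (norm_nonneg c)]
  simp only [norm_smul, mul_assoc]

theorem isTopologicalAddGroup_hInfTopology (v : Weight) :
    @IsTopologicalAddGroup v.HInf v.hInfTopology _ := by
  let := v.hInfNorm.toNormedAddCommGroup
  exact SeminormedAddCommGroup.toIsTopologicalAddGroup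

theorem continuousSMul_hInfTopology (v : Weight) :
    @ContinuousSMul ℂ v.HInf _ _ v.hInfTopology := by
  let := v.hInfNorm.toNormedAddCommGroup
  let : NormedSpace ℂ v.HInf := ⟨fun c f => (v.hInfNorm_smul c f).le⟩
  exact IsBoundedSMul.continuousSMul

theorem locallyConvexSpace_hInfTopology (v : Weight) :
    @LocallyConvexSpace ℝ v.HInf _ _ _ _ v.hInfTopology := by
  let := v.hInfNorm.toNormedAddCommGroup
  let : NormedSpace ℝ v.HInf :=
    ⟨fun c f => ((v.hInfNorm_smul (c : ℂ) f).trans (by rw [Complex.norm_real]; rfl)).le⟩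
  exact NormedSpace.toLocallyConvexSpace

/-- The topology that `HInd V` inherits from each `W n` is one of those competing in the definition
of `hIndTopology`, hence coarser than it. -/
theorem contInclIndProj_of_contIncl {V W : ℕ+ → Weight}
    (h : ∀ m n, ContIncl (V m) (W n)) : ContInclIndProj V W := by
  have hle : HInd V ≤ HProj W := iSup_le fun m => le_iInf fun n => (h m n).1
  refine ⟨hle, continuous_iInf_rng.2 fun n => continuous_induced_rng.2 ?_⟩
  let tW := (W n).hInfTopology
  have := isTopologicalAddGroup_hInfTopology (W n)
  have := continuousSMul_hInfTopology (W n)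
  have := locallyConvexSpace_hInfTopology (W n)
  have hle' : HInd V ≤ (W n).HInf := hle.trans (hProj_le_hInf W n)
  change Continuous[hIndTopology V, tW] (Submodule.inclusion hle')
  refine continuous_iff_le_induced.2 (sInf_le ⟨?_, ?_, ?_, fun m => ?_⟩)
  · exact topologicalAddGroup_induced (Submodule.inclusion hle')
  · exact continuousSMul_induced (Submodule.inclusion hle')
  · exact LocallyConvexSpace.induced ((Submodule.inclusion hle').restrictScalars ℝ)
  · exact continuous_induced_rng.2 (h m n).2

/-! ### The weight of the associated sequence -/

theorem bddAbove_log_div_assocSeq (u : Weight) {t : ℝ≥0} (ht : 0 < t) :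
    BddAbove (Set.range fun j : ℕ => Real.log ((t : ℝ) ^ j / u.assocSeq j)) := by
  have ht0 : (0 : ℝ) < t := by exact_mod_cast ht
  refine ⟨Real.log (u t)⁻¹, ?_⟩
  rintro _ ⟨j, rfl⟩
  refine Real.log_le_log (div_pos (pow_pos ht0 j) (u.assocSeq_pos j)) ?_
  rw [div_le_iff₀ (u.assocSeq_pos j), ← div_eq_inv_mul, le_div_iff₀ (u.pos t)]
  exact u.pow_mul_le_assocSeq j ht

theorem le_seqWeight (u : Weight) {t : ℝ≥0} (ht : 0 < t) : u t ≤ seqWeight u.assocSeq t := by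
  have ht0 : (0 : ℝ) < t := by exact_mod_cast ht
  rw [seqWeight, assocFun, if_neg ht.ne', ← Real.log_le_iff_le_exp (u.pos t), le_neg]
  refine ciSup_le fun j => ?_
  rw [← Real.log_inv]
  refine Real.log_le_log (div_pos (pow_pos ht0 j) (u.assocSeq_pos j)) ?_
  rw [div_le_iff₀ (u.assocSeq_pos j), ← div_eq_inv_mul, le_div_iff₀ (u.pos t)]
  exact u.pow_mul_le_assocSeq j ht

/-- Since `v_M(t) = inf_j M_j / t ^ j`, the single index from `exists_assocSeq_le` suffices. -/
theorem IsConvex.seqWeight_le {u : Weight} (huc : u.IsConvex) (hu : u.IsNormalized)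
    {t : ℝ≥0} (ht : 1 ≤ t) : seqWeight u.assocSeq t ≤ t * u t := by
  have ht' : 0 < t := one_pos.trans_le ht
  have ht0 : (0 : ℝ) < t := by exact_mod_cast ht'
  obtain ⟨j, hj⟩ := huc.exists_assocSeq_le hu ht
  rw [seqWeight, assocFun, if_neg ht'.ne', ← Real.le_log_iff_exp_le (mul_pos ht0 (u.pos t)), neg_le,
    ← Real.log_inv]
  refine le_trans ?_ (le_ciSup (u.bddAbove_log_div_assocSeq ht') j)
  refine Real.log_le_log (inv_pos.2 (mul_pos ht0 (u.pos t))) ?_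
  rw [le_div_iff₀ (u.assocSeq_pos j), ← div_eq_inv_mul, div_le_iff₀ (mul_pos ht0 (u.pos t))]
  exact hj.trans_eq (by ring)

/-- Uses `v_{M^w} ≤ t w` and `u ≤ v_{M^u}`; half of `w ^ c` pays for `u`, the other half absorbs `t
^ c`. -/
theorem strongRelPow_seqWeight_of_strongRelPow {u w : Weight} (hw : w.IsNormalized)
    (hwc : w.IsConvex) (h : StrongRelPow u w) :
    StrongRelPow (seqWeight u.assocSeq) (seqWeight w.assocSeq) := by
  intro c hc
  obtain ⟨k, hk⟩ := exists_nat_ge c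
  obtain ⟨C, -, hC⟩ := exists_rpow_le_of_strongRelPow hw h one_pos (half_pos hc)
  have hlim : Tendsto (fun t : ℝ≥0 => C * ((t : ℝ) ^ k * w t ^ (c / 2))) atTop (𝓝 0) := by
    simpa using (w.tendsto_pow_mul_rpow (half_pos hc) k).const_mul C
  refine isLittleO_of_eventually_le_mul ?_ hlim
  filter_upwards [eventually_ge_atTop 1] with t ht
  have ht1 : (1 : ℝ) ≤ t := by exact_mod_cast ht
  have hwp : ∀ a : ℝ, 0 < w t ^ a := fun a => Real.rpow_pos_of_pos (w.pos t) a
  have hu1 := u.le_seqWeight (one_pos.trans_le ht)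
  have hC0 : w t ^ (c / 2) ≤ C * u t := by simpa using hC t
  have hCp : 0 ≤ C := le_of_mul_le_mul_right
    ((zero_mul (u t)).trans_le ((hwp _).le.trans hC0)) (u.pos t)
  have hs0 : 0 ≤ seqWeight w.assocSeq t := (Real.exp_pos _).le
  have hsu0 : 0 ≤ seqWeight u.assocSeq t := (Real.exp_pos _).le
  rw [Real.norm_of_nonneg (Real.rpow_nonneg hs0 _), Real.norm_of_nonneg hsu0]
  calc seqWeight w.assocSeq t ^ c ≤ (t * w t) ^ c :=
        Real.rpow_le_rpow hs0 (hwc.seqWeight_le hw ht) hc.le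
    _ = (t : ℝ) ^ c * (w t ^ (c / 2) * w t ^ (c / 2)) := by
        rw [Real.mul_rpow t.coe_nonneg (w.pos t).le, ← Real.rpow_add (w.pos t), add_halves]
    _ ≤ (t : ℝ) ^ k * (w t ^ (c / 2) * (C * u t)) := by
        refine mul_le_mul ?_ (mul_le_mul_of_nonneg_left hC0 (hwp _).le)
          (mul_pos (hwp _) (hwp _)).le (by positivity)
        rw [← Real.rpow_natCast]
        exact Real.rpow_le_rpow_of_exponent_le ht1 hk
    _ = C * ((t : ℝ) ^ k * w t ^ (c / 2)) * u t := by ring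
    _ ≤ _ := mul_le_mul_of_nonneg_left hu1
        (mul_nonneg hCp (mul_nonneg (by positivity) (hwp _).le))

theorem strongRelPow_of_strongRelPow_seqWeight {u w : Weight} (hu : u.IsNormalized)
    (huc : u.IsConvex)
    (h : StrongRelPow (seqWeight u.assocSeq) (seqWeight w.assocSeq)) : StrongRelPow u w := by
  intro c hc
  have hlim : Tendsto (fun t : ℝ≥0 => (t : ℝ) ^ 1 * w t ^ (c / 2)) atTop (𝓝 0) :=
    w.tendsto_pow_mul_rpow (half_pos hc) 1
  refine isLittleO_of_eventually_le_mul ?_ hlim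
  filter_upwards [eventually_ge_atTop 1,
    isLittleO_iff.1 (h (c / 2) (half_pos hc)) one_pos] with t ht h1
  have hwp : ∀ a : ℝ, 0 < w t ^ a := fun a => Real.rpow_pos_of_pos (w.pos t) a
  have hs0 : 0 ≤ seqWeight w.assocSeq t := (Real.exp_pos _).le
  have hsu0 : 0 ≤ seqWeight u.assocSeq t := (Real.exp_pos _).le
  rw [Real.norm_of_nonneg (Real.rpow_nonneg hs0 _), one_mul,
    Real.norm_of_nonneg hsu0] at h1
  rw [Real.norm_of_nonneg (hwp _).le, Real.norm_of_nonneg (u.pos t).le]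
  calc w t ^ c = w t ^ (c / 2) * w t ^ (c / 2) := by
        rw [← Real.rpow_add (w.pos t), add_halves]
    _ ≤ (t * u t) * w t ^ (c / 2) := by
        refine mul_le_mul_of_nonneg_right ?_ (hwp _).le
        exact (Real.rpow_le_rpow (w.pos t).le (w.le_seqWeight (one_pos.trans_le ht))
          (half_pos hc).le).trans (h1.trans (huc.seqWeight_le hu ht))
    _ = _ := by ring

/-! ### Comparison of the associated sequences -/

/-- Raise `w ^ (1/d) ≤ C u` to the power `d`, multiply by `t ^ (d j)` and take the supremum over
`t`. -/
theorem exists_assocSeq_le_of_strongRelPow {u w : Weight} (hw : w.IsNormalized)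
    (h : StrongRelPow u w) {d : ℕ} (hd : 1 ≤ d) :
    ∃ C : ℝ, 1 ≤ C ∧ ∀ j : ℕ, w.assocSeq (d * j) ^ (1 / (d : ℝ)) ≤ C * u.assocSeq j := by
  have hd0 : (0 : ℝ) < d := by exact_mod_cast hd
  obtain ⟨C, hC1, hC⟩ := exists_rpow_le_of_strongRelPow hw h one_pos (one_div_pos.2 hd0)
  refine ⟨C, hC1, fun j => ?_⟩
  have hR : 0 ≤ C * u.assocSeq j := mul_nonneg (zero_le_one.trans hC1) (u.assocSeq_pos j).le
  rw [one_div, Real.rpow_inv_le_iff_of_pos (w.assocSeq_pos _).le hR hd0]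
  refine w.assocSeq_le _ fun t ht => ?_
  have h1 : w t ≤ (C * u t) ^ (d : ℝ) := by
    have h2 := hC t
    rw [Real.rpow_one] at h2
    rwa [one_div, Real.rpow_inv_le_iff_of_pos (w.pos t).le
      ((Real.rpow_pos_of_pos (w.pos t) _).le.trans h2) hd0] at h2
  rw [Real.rpow_natCast] at h1 ⊢
  calc (t : ℝ) ^ (d * j) * w t ≤ (t : ℝ) ^ (d * j) * (C * u t) ^ d :=
        mul_le_mul_of_nonneg_left h1 (by positivity)
    _ = (C * ((t : ℝ) ^ j * u t)) ^ d := by rw [mul_comm d j, pow_mul]; ring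
    _ ≤ (C * u.assocSeq j) ^ d := by
        refine pow_le_pow_left₀ (mul_nonneg (zero_le_one.trans hC1)
          (mul_nonneg (by positivity) (u.pos t).le)) ?_ d
        exact mul_le_mul_of_nonneg_left (u.pow_mul_le_assocSeq j ht) (zero_le_one.trans hC1)

theorem strongRelPow_of_assocSeq_le {u w : Weight} (hu : u.IsNormalized) (huc : u.IsConvex)
    (hw : w.IsNormalized)
    (h : ∀ d : ℕ, 1 ≤ d → ∃ C : ℝ, 1 ≤ C ∧ ∀ j : ℕ,
      w.assocSeq (d * j) ^ (1 / (d : ℝ)) ≤ C * u.assocSeq j) : StrongRelPow u w := by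
  refine strongRelPow_of_pow_mul_rpow_le hu huc hw fun d hd => ?_
  obtain ⟨C, -, hC⟩ := h d hd
  have hd0 : (0 : ℝ) < d := by exact_mod_cast hd
  refine ⟨C, fun j t ht => le_trans ?_ (hC j)⟩
  have h1 := Real.rpow_le_rpow (mul_nonneg (by positivity) (w.pos t).le)
    (w.pow_mul_le_assocSeq (d * j) (one_pos.trans_le ht)) (one_div_pos.2 hd0).le
  rw [Real.mul_rpow (by positivity) (w.pos t).le, mul_comm d j, pow_mul, one_div,
    Real.pow_rpow_inv_natCast (by positivity) (by omega)] at h1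
  rwa [one_div, mul_comm d j]

end Weight

theorem mainTheorem6 (u w : Weight) (hu : u.IsNormalized) (hw : w.IsNormalized)
    (huc : u.IsConvex) :
    List.TFAE [
      StrongRelPow u w,
      ∀ (c d : ℝ) (hc : 0 < c) (hd : 0 < d), Weight.ContIncl (u.rpow c hc) (w.rpow d hd),
      ∀ (c d : ℝ) (hc : 0 < c) (hd : 0 < d), (u.rpow c hc).HInf ≤ (w.rpow d hd).HInf,
      ∃ c : ℕ, ∃ hc : 0 < (c : ℝ), ∀ (d : ℝ) (hd : 0 < d),
        Weight.ContIncl (u.rpow c hc) (w.rpow d hd),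
      ∃ c : ℕ, ∃ hc : 0 < (c : ℝ), ∀ (d : ℝ) (hd : 0 < d),
        (u.rpow c hc).HInf ≤ (w.rpow d hd).HInf,
      Weight.ContInclIndProj u.indExp w.projExp,
      Weight.HInd u.indExp ≤ Weight.HProj w.projExp] ∧
    (w.IsConvex →
      List.TFAE [
        StrongRelPow u w,
        StrongRelPow (seqWeight u.assocSeq) (seqWeight w.assocSeq),
        ∀ d : ℕ, 1 ≤ d → ∃ C : ℝ, 1 ≤ C ∧ ∀ j : ℕ,
          w.assocSeq (d * j) ^ (1 / (d : ℝ)) ≤ C * u.assocSeq j]) := by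
  have h12 : StrongRelPow u w → ∀ (c d : ℝ) (hc : 0 < c) (hd : 0 < d),
      Weight.ContIncl (u.rpow c hc) (w.rpow d hd) := fun h c d hc hd => by
    obtain ⟨C, -, hC⟩ := Weight.exists_rpow_le_of_strongRelPow hw h hc hd
    exact Weight.contIncl_of_le (C := C) hC
  -- As `u ≤ 1`, integer powers only enlarge the space, so an inclusion for one `c` already gives it
  -- for `u` itself.
  have hpow : ∀ (c : ℕ) (hc : 0 < (c : ℝ)), u.HInf ≤ (u.rpow c hc).HInf := fun c hc => by
    refine Weight.hInf_mono (C := 1) fun t => ?_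
    change u t ^ (c : ℝ) ≤ 1 * u t
    rw [one_mul, Real.rpow_natCast]
    exact pow_le_of_le_one (u.pos t).le (hu.le_one t) (by rintro rfl; simp at hc)
  refine ⟨?_, fun hwc => ?_⟩
  · tfae_have 1 → 2 := h12
    tfae_have 2 → 3 := fun h c d hc hd => (h c d hc hd).1
    tfae_have 2 → 4 := fun h => ⟨1, by simp, fun d hd => h _ d _ hd⟩
    tfae_have 4 → 5 := fun ⟨c, hc, h⟩ => ⟨c, hc, fun d hd => (h d hd).1⟩
    tfae_have 3 → 5 := fun h => ⟨1, by simp, fun d hd => h _ d _ hd⟩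
    tfae_have 5 → 1 := fun ⟨c, hc, h⟩ => Weight.strongRelPow_of_hInf_le hu huc hw
      fun n hn => (hpow c hc).trans (h _ hn)
    tfae_have 1 → 6 := fun h => Weight.contInclIndProj_of_contIncl fun m n => h12 h _ _ _ _
    tfae_have 6 → 7 := fun ⟨h, _⟩ => h
    tfae_have 7 → 1 := fun h => Weight.strongRelPow_of_hInf_le hu huc hw fun n hn => by
      -- `1 / 0 = 0`, so `hn` excludes `n = 0`.
      have hn0 : 0 < n := by
        rcases Nat.eq_zero_or_pos n with rfl | h0
        · simp at hn
        · exact h0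
      exact (hpow (1 : ℕ+) (by simp)).trans <| (Weight.hInf_le_hInd u.indExp 1).trans <|
        h.trans (Weight.hProj_le_hInf w.projExp ⟨n, hn0⟩)
    tfae_finish
  · tfae_have 1 → 2 := Weight.strongRelPow_seqWeight_of_strongRelPow hw hwc
    tfae_have 2 → 1 := Weight.strongRelPow_of_strongRelPow_seqWeight hu huc
    tfae_have 1 → 3 := fun h d hd => Weight.exists_assocSeq_le_of_strongRelPow hw h hd
    tfae_have 3 → 1 := Weight.strongRelPow_of_assocSeq_le hu huc hw
    tfae_finish
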